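/- Let $\mathcal D\subset\mathbb R^d$ be a bounded open set, let $\Delta t>0$, and let $a:\mathbb R^d\to\mathbb R^d$ and $b:\mathbb R^d\to\mathbb R^{d\times k}$ be globally Lipschitz. For $x\in\mathcal D$ let $\kappa(x)$ be the law, on the space of continuous paths $[0,\infty)\to\mathbb R^d$, of the solution of $$X_t=x+\int_0^t a(X_s)\,ds+\int_0^t b(X_s)\,dW_s ,$$ $W$ a $k$-dimensional standard Brownian motion, where $x\mapsto\kappa(x)$ is a Markov kernel. For a path $w$ let $\theta(w)=\inf\{t>0: w_t\notin\mathcal D\}$ be its first exit time from $\mathcal D$, and let $\mathbb P_{\rm exit}(x)=\kappa(x)\{\theta<\Delta t\}$ be the one-step exit probability from $x$ (the equation is autonomous, so the starting time is irrelevant). Assume: (i) $\mathbb P_{\rm exit}$ is $L$-Lipschitz on $\mathcal D$. (ii) $\rho$ is a probability density on $\mathcal D$ that is continuous on $\mathcal D$ with $0<\rho_{\min}\le\rho(x)\le\rho_{\max}<\infty$ for all $x\in\mathcal D$. The pairs $(x_m,Y_m)$, $m=1,2,\dots$, are i.i.d., where the starting point $x_m$ has density $\rho$ and, given $x_m$,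 the trajectory $Y_m$ has law $\kappa(x_m)$. The label of $x_m$ is the exit indicator $\gamma_m=\mathbf 1\{\theta(Y_m)<\Delta t\}$. (iii) $\mathcal H$ is a set of parameters $\eta$ of fully connected networks $$F_\eta(x)=\mathrm{sigmoid}\bigl(A^{(J)}\phi(A^{(J-1)}\phi(\cdots\phi(A^{(1)}x+B^{(1)})\cdots)+B^{(J-1)})+B^{(J)}\bigr)$$ with LeakyReLU activation $\phi$ of some slope $\alpha\in(0,1)$ on the negative half-line (the depth and the widths may vary within $\mathcal H$), such that every $F_\eta$, $\eta\in\mathcal H$, is $L_F$-Lipschitz on $\mathcal D$, and such that $\mathcal H$ has sufficient approximation capability: for every $L$-Lipschitz $g:\mathcal D\to[0,1]$ and every $\varepsilon>0$ there is $\eta\in\mathcal H$ with $|F_\eta(x)-g(x)|<\varepsilon$ for all $x\in\mathcal D$. For $M\ge1$ let $$\mathcal L_M(\eta)=-\frac1M\sum_{m=1}^M\bigl[\gamma_m\log F_\eta(x_m)+(1-\gamma_m)\log(1-F_\eta(x_m))\bigr]$$ be the empirical binary cross-entropy (BCE) loss, and let $\eta_M\in\mathcal H$ be (random) parameters whose loss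 converges to the global minimum: $\mathcal L_M(\eta_M)-\inf_{\eta\in\mathcal H}\mathcal L_M(\eta)\to0$ in probability as $M\to\infty$ (in particular, $\eta_M$ may be an exact global minimizer). Then $$\sup_{x\in\mathcal D}\bigl|F_{\eta_M}(x)-\mathbb P_{\rm exit}(x)\bigr|\longrightarrow0\quad\text{in probability as } M\to\infty .$$ -/

import Mathlib

open MeasureTheory ProbabilityTheory Filter Topology
open scoped NNReal ENNReal

noncomputable section

namespace ExitLearning

/-! ### Fully connected networks with LeakyReLU activation and sigmoid output -/

/-- The activation function LeakyReLU with negative slope `α`. -/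
def leakyReLU (α : ℝ) (z : ℝ) : ℝ := if 0 ≤ z then z else α * z

/-- The parameters (architecture, weights and biases) of a fully connected network with `n` inputs
and one output: any number of hidden layers `v ↦ φ (A v + B)` of any widths, followed by the scalar
affine output layer. -/
inductive Network : ℕ → Type
  | output {n : ℕ} (A : Fin n → ℝ) (B : ℝ) : Network n
  | hidden {n l : ℕ} (A : Matrix (Fin l) (Fin n) ℝ) (B : Fin l → ℝ) (rest : Network l) : Network n

/-- The value of the network before the final sigmoid. -/
def Network.logit (α : ℝ) : {n : ℕ} → Network n → (Fin n → ℝ) → ℝ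
  | _, .output A B, v => A ⬝ᵥ v + B
  | _, .hidden A B rest, v => rest.logit α (fun i => leakyReLU α ((A.mulVec v + B) i))

/-- The network function `F_η`. -/
def Network.eval (α : ℝ) {d : ℕ} (η : Network d) (x : EuclideanSpace ℝ (Fin d)) : ℝ :=
  Real.sigmoid (η.logit α (fun i => x i))

/-- The empirical binary cross-entropy loss of a function `F` on the first `M` pairs
(location, label). -/
def bceLoss {E : Type*} (F : E → ℝ) (x : ℕ → E) (γ : ℕ → ℝ) (M : ℕ) : ℝ :=
  -(1 / (M : ℝ)) * ∑ m ∈ Finset.range M,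
    (γ m * Real.log (F (x m)) + (1 - γ m) * Real.log (1 - F (x m)))

/-! ### The stochastic differential equation -/

/-- Continuous paths `[0, ∞) → ℝᵈ`, with the topology of locally uniform convergence. -/
abbrev PathSpace (d : ℕ) : Type := C(ℝ≥0, EuclideanSpace ℝ (Fin d))

instance (d : ℕ) : MeasurableSpace (PathSpace d) := borel _

instance (d : ℕ) : BorelSpace (PathSpace d) := ⟨rfl⟩

/-- `W` is a `k`-dimensional standard Brownian motion relative to the filtration `𝓕`. -/
structure IsBrownianMotion {Ω : Type*} {mΩ : MeasurableSpace Ω} (P : Measure Ω)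
    (𝓕 : Filtration ℝ≥0 mΩ) {k : ℕ} (W : ℝ≥0 → Ω → EuclideanSpace ℝ (Fin k)) : Prop where
  adapted : ∀ t, Measurable[𝓕 t] (W t)
  coord : ∀ i, IsBrownianReal (fun t ω => W t ω i) P
  coord_indep : iIndepFun (fun (i : Fin k) (ω : Ω) (t : ℝ≥0) => W t ω i) P
  increment_indep : ∀ s t, s ≤ t →
    Indep (MeasurableSpace.comap (fun ω => W t ω - W s ω) inferInstance) (𝓕 s) P

/-- The left-endpoint Riemann sum of the Itô integral `∫₀ᵗ b (X_s) dW_s` over the partition of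
`[0, t]` into `n` equal parts. -/
def itoSum {Ω : Type*} {d k : ℕ}
    (b : EuclideanSpace ℝ (Fin d) → EuclideanSpace ℝ (Fin k) →L[ℝ] EuclideanSpace ℝ (Fin d))
    (W : ℝ≥0 → Ω → EuclideanSpace ℝ (Fin k)) (X : Ω → PathSpace d) (t : ℝ≥0) (n : ℕ) (ω : Ω) :
    EuclideanSpace ℝ (Fin d) :=
  ∑ i ∈ Finset.range n,
    b (X ω ((i : ℝ≥0) * t / n)) (W (((i : ℝ≥0) + 1) * t / n) ω - W ((i : ℝ≥0) * t / n) ω)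

/-- `X` is a solution of `X_t = x + ∫₀ᵗ a (X_s) ds + ∫₀ᵗ b (X_s) dW_s`. As the integrand `b (X_s)`
is continuous and adapted, its Itô integral is the limit in probability of the left-endpoint
Riemann sums. -/
structure IsSDESolution {Ω : Type*} {mΩ : MeasurableSpace Ω} (P : Measure Ω)
    (𝓕 : Filtration ℝ≥0 mΩ) {d k : ℕ} (W : ℝ≥0 → Ω → EuclideanSpace ℝ (Fin k))
    (a : EuclideanSpace ℝ (Fin d) → EuclideanSpace ℝ (Fin d))
    (b : EuclideanSpace ℝ (Fin d) → EuclideanSpace ℝ (Fin k) →L[ℝ] EuclideanSpace ℝ (Fin d))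
    (x : EuclideanSpace ℝ (Fin d)) (X : Ω → PathSpace d) : Prop where
  brownian : IsBrownianMotion P 𝓕 W
  measurable : Measurable X
  adapted : ∀ t, Measurable[𝓕 t] (fun ω => X ω t)
  initial : ∀ᵐ ω ∂P, X ω 0 = x
  equation : ∀ t : ℝ≥0, TendstoInMeasure P (fun n ω => itoSum b W X t n ω) atTop
    (fun ω => X ω t - x - ∫ s in (0 : ℝ)..t, a (X ω s.toNNReal))

/-- `Q` is the law on path space of the solution of the stochastic differential equation with
drift `a` and diffusion coefficient `b` started at `x`. -/
def IsSDELaw {d k : ℕ} (a : EuclideanSpace ℝ (Fin d) → EuclideanSpace ℝ (Fin d))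
    (b : EuclideanSpace ℝ (Fin d) → EuclideanSpace ℝ (Fin k) →L[ℝ] EuclideanSpace ℝ (Fin d))
    (x : EuclideanSpace ℝ (Fin d)) (Q : Measure (PathSpace d)) : Prop :=
  ∃ (Ω : Type) (mΩ : MeasurableSpace Ω) (P : Measure Ω) (𝓕 : Filtration ℝ≥0 mΩ)
    (W : ℝ≥0 → Ω → EuclideanSpace ℝ (Fin k)) (X : Ω → PathSpace d),
    IsProbabilityMeasure P ∧ IsSDESolution P 𝓕 W a b x X ∧ P.map X = Q

/-! ### Exit time, exit probability, exit indicator -/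

/-- The first exit time `inf {t > 0 | w t ∉ D}` of a path (`∞` if the path never leaves `D`). -/
def exitTime {d : ℕ} (D : Set (EuclideanSpace ℝ (Fin d))) (w : PathSpace d) : ℝ≥0∞ :=
  ⨅ (t : ℝ≥0) (_ : 0 < t ∧ w t ∉ D), (t : ℝ≥0∞)

/-- The probability, under the law `Q` of the path, of an exit within one time step of length
`Δt`. -/
def exitProb {d : ℕ} (D : Set (EuclideanSpace ℝ (Fin d))) (Δt : ℝ≥0) (Q : Measure (PathSpace d)) : ℝ :=
  Q.real {w | exitTime D w < Δt}

open Classical in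
/-- The binary label of a trajectory: `1` if it exits `D` within one time step, `0` otherwise. -/
def exitIndicator {d : ℕ} (D : Set (EuclideanSpace ℝ (Fin d))) (Δt : ℝ≥0) (w : PathSpace d) : ℝ :=
  if exitTime D w < Δt then 1 else 0

end ExitLearning

end

open ExitLearning

/-! Let `p` be the exit probability and `ν` the law of the starting points. The expected
cross-entropy of `G` is `∫ crossEntropy (G z) (p z) ∂ν`, and its excess over the value at `G = p` is
an integrated Kullback–Leibler divergence, at least `(p - G) ^ 2 / 4` pointwise
(`crossEntropy_self_add_le`). A Lipschitz network far from `p` at one point is far on a ball of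
fixed radius, whose `ν`-mass is bounded below uniformly (`exists_pos_le_measureReal_ball`), so its
excess risk is at least a fixed `Γ`. Yet some network has arbitrarily small excess risk
(`exists_comparator`), and a near-minimiser cannot do much worse empirically.

Passing from empirical loss to risk uniformly over `H` is the difficulty: the logarithms are
unbounded as outputs approach `0` or `1`. The common Lipschitz constant gives a finite sup-norm
cover of `H`, whatever the architectures (`exists_finite_uniform_approx`). Smoothing a cover element
bounds its loss and raises it by little over that of any nearby network
(`crossEntropy_smoothed_le`). This one-sided comparison suffices, so the law of large numbers is
needed only for finitely many bounded losses. -/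

noncomputable section

namespace ExitLearning

/-! ### Binary cross-entropy -/

/-- The cross-entropy of the Bernoulli law of parameter `q` relative to that of parameter `p`. -/
def crossEntropy (q p : ℝ) : ℝ := -(p * Real.log q + (1 - p) * Real.log (1 - q))

theorem crossEntropy_nonneg {q p : ℝ} (hq0 : 0 ≤ q) (hq1 : q ≤ 1) (hp0 : 0 ≤ p) (hp1 : p ≤ 1) :
    0 ≤ crossEntropy q p := by
  have h1 := Real.log_nonpos hq0 hq1
  have h2 := Real.log_nonpos (x := 1 - q) (by linarith) (by linarith)
  have h3 := mul_nonneg hp0 (neg_nonneg.2 h1)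
  have h4 := mul_nonneg (sub_nonneg.2 hp1) (neg_nonneg.2 h2)
  unfold crossEntropy
  linarith

/-- This is `log t ≤ t - 1` at `t = √(q / p)`; summed over both outcomes it bounds the divergence
below by the squared Hellinger distance. -/
theorem two_mul_sub_sqrt_le_mul_log_sub {p q : ℝ} (hp : 0 ≤ p) (hq : 0 < q) :
    2 * (p - √p * √q) ≤ p * (Real.log p - Real.log q) := by
  rcases hp.eq_or_lt with rfl | hp
  · simp
  have h := Real.log_le_sub_one_of_pos (x := √(q / p)) (by positivity)
  rw [Real.log_sqrt (by positivity), Real.log_div hq.ne' hp.ne', Real.sqrt_div hq.le] at h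
  have h2 : √p * √q = p * (√q / √p) := by
    have := Real.sq_sqrt hp.le
    have := Real.sqrt_pos.2 hp
    field_simp
    nlinarith
  rw [h2]
  nlinarith [mul_le_mul_of_nonneg_left h hp.le]

theorem mul_log_sub_le {p q : ℝ} (hp : 0 ≤ p) (hq : 0 < q) :
    p * (Real.log p - Real.log q) ≤ p * (p / q - 1) := by
  rcases hp.eq_or_lt with rfl | hp
  · simp
  rw [← Real.log_div hp.ne' hq.ne']
  exact mul_le_mul_of_nonneg_left (Real.log_le_sub_one_of_pos (by positivity)) hp.le

/-- The divergence dominates `(√p - √q) ^ 2`, and `√p + √q ≤ 2` turns this into a quarter of `(p -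
q) ^ 2`. -/
theorem crossEntropy_self_add_le {p q : ℝ} (hp0 : 0 ≤ p) (hp1 : p ≤ 1) (hq0 : 0 < q) (hq1 : q < 1) :
    crossEntropy p p + (p - q) ^ 2 / 4 ≤ crossEntropy q p := by
  have h1 := two_mul_sub_sqrt_le_mul_log_sub hp0 hq0
  have h2 := two_mul_sub_sqrt_le_mul_log_sub (sub_nonneg.2 hp1) (sub_pos.2 hq1)
  have e1 := Real.sq_sqrt hp0
  have e2 := Real.sq_sqrt hq0.le
  have e3 := Real.sq_sqrt (sub_nonneg.2 hp1)
  have e4 := Real.sq_sqrt (sub_pos.2 hq1).le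
  have l1 := Real.sqrt_le_one.2 hp1
  have l2 := Real.sqrt_le_one.2 hq1.le
  have n1 := Real.sqrt_nonneg p
  have n2 := Real.sqrt_nonneg q
  have h3 : (p - q) ^ 2 ≤ 4 * (√p - √q) ^ 2 := by
    have : p - q = (√p - √q) * (√p + √q) := by linarith
    rw [this, mul_pow, mul_comm]
    refine mul_le_mul_of_nonneg_right ?_ (sq_nonneg _)
    nlinarith
  unfold crossEntropy
  nlinarith [sq_nonneg (√(1 - p) - √(1 - q))]

/-- Kullback–Leibler is at most the chi-square divergence. -/
theorem crossEntropy_le_self_add {p q : ℝ} (hp0 : 0 ≤ p) (hp1 : p ≤ 1) (hq0 : 0 < q) (hq1 : q < 1) :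
    crossEntropy q p ≤ crossEntropy p p + (p - q) ^ 2 / (q * (1 - q)) := by
  have h1 := mul_log_sub_le hp0 hq0
  have h2 := mul_log_sub_le (sub_nonneg.2 hp1) (sub_pos.2 hq1)
  have h3 : (p - q) ^ 2 / (q * (1 - q)) = p * (p / q - 1) + (1 - p) * ((1 - p) / (1 - q) - 1) := by
    have := sub_pos.2 hq1
    field_simp
    ring
  unfold crossEntropy
  rw [h3]
  linarith

/-- The Bernoulli parameter `q` moved away from `0` and `1`. -/
def smoothed (δ q : ℝ) : ℝ := (q + δ) / (1 + 2 * δ)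

theorem smoothed_mem {δ q : ℝ} (hδ : 0 < δ) (hδ1 : δ ≤ 1) (hq0 : 0 ≤ q) (hq1 : q ≤ 1) :
    δ / 3 ≤ smoothed δ q ∧ smoothed δ q ≤ 1 - δ / 3 := by
  unfold smoothed
  rw [le_div_iff₀ (by positivity), div_le_iff₀ (by positivity)]
  constructor <;> nlinarith

theorem abs_smoothed_sub_le {δ q : ℝ} (hδ : 0 < δ) (hq0 : 0 ≤ q) (hq1 : q ≤ 1) :
    |smoothed δ q - q| ≤ δ := by
  have : smoothed δ q - q = δ * (1 - 2 * q) / (1 + 2 * δ) := by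
    unfold smoothed
    field_simp
    ring
  rw [this, abs_div, abs_mul, abs_of_pos hδ, abs_of_pos (by positivity : 0 < 1 + 2 * δ),
    div_le_iff₀ (by positivity)]
  have : |1 - 2 * q| ≤ 1 := abs_le.2 ⟨by linarith, by linarith⟩
  nlinarith

theorem log_add_sub_log_add_le {δ q q' : ℝ} (hδ : 0 < δ) (hq : 0 ≤ q) (hq' : 0 ≤ q') :
    Real.log (q + δ) - Real.log (q' + δ) ≤ |q - q'| / δ := by
  rw [← Real.log_div (by positivity) (by positivity)]
  refine (Real.log_le_sub_one_of_pos (by positivity)).trans ?_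
  have : (q + δ) / (q' + δ) - 1 = (q - q') / (q' + δ) := by field_simp; ring
  rw [this]
  exact div_le_div₀ (abs_nonneg _) (le_abs_self _) hδ (by linarith)

/-- Changing `q` to a smoothed nearby parameter hardly increases the cross-entropy. -/
theorem crossEntropy_smoothed_le {δ r q q' p : ℝ} (hδ : 0 < δ) (hq0 : 0 < q) (hq1 : q < 1)
    (hq0' : 0 ≤ q') (hq1' : q' ≤ 1) (hp0 : 0 ≤ p) (hp1 : p ≤ 1) (hr : |q - q'| ≤ r) :
    crossEntropy (smoothed δ q') p ≤ crossEntropy q p + (r / δ + 2 * δ) := by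
  have hl : Real.log (1 + 2 * δ) ≤ 2 * δ := by
    have := Real.log_le_sub_one_of_pos (x := 1 + 2 * δ) (by positivity)
    linarith
  have key : ∀ {s s' : ℝ}, 0 < s → 0 ≤ s' → |s - s'| ≤ r →
      Real.log s - Real.log ((s' + δ) / (1 + 2 * δ)) ≤ r / δ + 2 * δ := fun {s s'} hs hs' hsr => by
    rw [Real.log_div (by positivity) (by positivity)]
    have h1 := log_add_sub_log_add_le hδ hs.le hs'
    -- Only this direction is uniform in `s`: as `s` tends to `0` the two logarithms drift apart.
    have h2 : Real.log s ≤ Real.log (s + δ) := Real.log_le_log hs (by linarith)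
    have h3 : |s - s'| / δ ≤ r / δ := by gcongr
    linarith
  have h1 := key hq0 hq0' hr
  have h2 := key (s := 1 - q) (s' := 1 - q') (by linarith) (by linarith)
    (by rw [abs_sub_comm]; convert hr using 2; ring)
  have h3 : 1 - smoothed δ q' = (1 - q' + δ) / (1 + 2 * δ) := by
    unfold smoothed; field_simp; ring
  have h4 := mul_le_mul_of_nonneg_left h1 hp0
  have h5 := mul_le_mul_of_nonneg_left h2 (sub_nonneg.2 hp1)
  unfold crossEntropy
  rw [h3]
  unfold smoothed
  linarith

theorem abs_crossEntropy_le {c q p : ℝ} (hc : 0 < c) (hq0 : c ≤ q) (hq1 : q ≤ 1 - c) (hp0 : 0 ≤ p)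
    (hp1 : p ≤ 1) : |crossEntropy q p| ≤ -Real.log c := by
  rw [abs_of_nonneg (crossEntropy_nonneg (by linarith) (by linarith) hp0 hp1)]
  have h1 := mul_le_mul_of_nonneg_left (Real.log_le_log hc hq0) hp0
  have h2 := mul_le_mul_of_nonneg_left (Real.log_le_log hc (by linarith : c ≤ 1 - q))
    (sub_nonneg.2 hp1)
  unfold crossEntropy
  linarith

theorem bceLoss_eq {E : Type*} (F : E → ℝ) (x : ℕ → E) (γ : ℕ → ℝ) (M : ℕ) :
    bceLoss F x γ M = (∑ m ∈ Finset.range M, crossEntropy (F (x m)) (γ m)) / M := by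
  simp only [bceLoss, crossEntropy, Finset.sum_neg_distrib]
  ring

theorem bceLoss_nonneg {E : Type*} {F : E → ℝ} (hF : ∀ z, 0 ≤ F z ∧ F z ≤ 1) {x : ℕ → E}
    {γ : ℕ → ℝ} (hγ : ∀ m, 0 ≤ γ m ∧ γ m ≤ 1) (M : ℕ) : 0 ≤ bceLoss F x γ M := by
  rw [bceLoss_eq]
  exact div_nonneg (Finset.sum_nonneg fun m _ =>
    crossEntropy_nonneg (hF _).1 (hF _).2 (hγ m).1 (hγ m).2) (Nat.cast_nonneg M)

theorem bceLoss_le_add {E : Type*} {F G : E → ℝ} {x : ℕ → E} {γ : ℕ → ℝ} {s : ℝ} {M : ℕ}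
    (hs : 0 ≤ s) (h : ∀ m, crossEntropy (G (x m)) (γ m) ≤ crossEntropy (F (x m)) (γ m) + s) :
    bceLoss G x γ M ≤ bceLoss F x γ M + s := by
  rw [bceLoss_eq, bceLoss_eq]
  rcases M.eq_zero_or_pos with rfl | hM
  · simpa
  have hM : (0 : ℝ) < M := Nat.cast_pos.2 hM
  rw [div_add' _ _ _ hM.ne', div_le_div_iff_of_pos_right hM]
  refine (Finset.sum_le_sum fun m _ => h m).trans_eq ?_
  rw [Finset.sum_add_distrib, Finset.sum_const, Finset.card_range, nsmul_eq_mul, mul_comm s]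

/-! ### Covers of Lipschitz classes -/

/-- Evaluation on a finite net of `D` sends `H` into a cube, which is totally bounded; the Lipschitz
bound carries closeness on the net to all of `D`. -/
theorem exists_finite_uniform_approx {E : Type*} [PseudoMetricSpace E] {D : Set E}
    (hD : TotallyBounded D) {ι : Type*} {H : Set ι} {F : ι → E → ℝ} {K : ℝ≥0}
    (hK : ∀ θ ∈ H, LipschitzOnWith K (F θ) D) (hF : ∀ θ ∈ H, ∀ z, 0 ≤ F θ z ∧ F θ z ≤ 1)
    {r : ℝ} (hr : 0 < r) :
    ∃ T ⊆ H, T.Finite ∧ ∀ θ ∈ H, ∃ τ ∈ T, ∀ z ∈ D, |F θ z - F τ z| ≤ r := by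
  -- Moving to the net and back costs `2 * K * s`, comparing values on the net costs `s`.
  set s : ℝ := r / (2 * K + 1) with hs
  have hs0 : 0 < s := by positivity
  obtain ⟨N, hND, hNfin, hN⟩ := Metric.finite_approx_of_totallyBounded hD s hs0
  have := hNfin.fintype
  let ev : ι → N → ℝ := fun θ y => F θ y
  have hev : TotallyBounded (ev '' H) := by
    refine (isCompact_Icc (a := (0 : N → ℝ)) (b := 1)).totallyBounded.subset ?_
    rintro _ ⟨θ, hθ, rfl⟩
    exact ⟨fun y => (hF θ hθ y).1, fun y => (hF θ hθ y).2⟩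
  obtain ⟨T', hT'sub, hT'fin, hT'⟩ := Metric.finite_approx_of_totallyBounded hev s hs0
  obtain ⟨T, hTH, rfl⟩ := Set.subset_image_iff.1 hT'sub
  -- Only the image of `T` is known to be finite, so one parameter is kept per value vector.
  obtain ⟨T₀, hT₀, hT₀'⟩ := Set.exists_subset_bijOn T ev
  refine ⟨T₀, hT₀.trans hTH, ?_, fun θ hθ => ?_⟩
  · exact Set.Finite.of_finite_image (hT₀'.image_eq ▸ hT'fin) hT₀'.injOn
  obtain ⟨_, hv, hball⟩ := Set.mem_iUnion₂.1 (hT' ⟨θ, hθ, rfl⟩)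
  rw [← hT₀'.image_eq] at hv
  obtain ⟨τ, hτ, rfl⟩ := hv
  refine ⟨τ, hτ, fun z hz => ?_⟩
  obtain ⟨y, hy, hzy⟩ := Set.mem_iUnion₂.1 (hN hz)
  have h1 := (hK θ hθ).dist_le_mul z hz y (hND hy)
  have h2 := (hK τ (hTH (hT₀ hτ))).dist_le_mul y (hND hy) z hz
  have h3 : dist (F θ y) (F τ y) ≤ s :=
    (dist_le_pi_dist (ev θ) (ev τ) ⟨y, hy⟩).trans (Metric.mem_ball.1 hball).le
  have h4 : (K : ℝ) * dist z y ≤ K * s :=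
    mul_le_mul_of_nonneg_left (Metric.mem_ball.1 hzy).le K.2
  rw [dist_comm y z] at h2
  have h5 : (2 * K + 1) * s = r := by rw [hs]; field_simp
  rw [← Real.dist_eq]
  linarith [dist_triangle4 (F θ z) (F θ y) (F τ y) (F τ z)]

/-- A measure charging all balls around points of a totally bounded set charges the balls of a given
radius uniformly. -/
theorem exists_pos_le_measureReal_ball {E : Type*} [PseudoMetricSpace E] [MeasurableSpace E]
    {ν : Measure E} [IsFiniteMeasure ν] {D : Set E} (hD : TotallyBounded D)
    (hν : ∀ z ∈ D, ∀ r > 0, 0 < ν (Metric.ball z r)) {r : ℝ} (hr : 0 < r) :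
    ∃ c > 0, ∀ z ∈ D, c ≤ ν.real (Metric.ball z r) := by
  obtain ⟨N, hND, hNfin, hN⟩ := Metric.finite_approx_of_totallyBounded hD (r / 2) (half_pos hr)
  rcases N.eq_empty_or_nonempty with rfl | hne
  · refine ⟨1, one_pos, fun z hz => ?_⟩
    simpa using hN hz
  obtain ⟨y₀, hy₀, hmin⟩ :=
    Set.exists_min_image N (fun y => ν.real (Metric.ball y (r / 2))) hNfin hne
  refine ⟨_, ENNReal.toReal_pos (hν y₀ (hND hy₀) _ (half_pos hr)).ne' (measure_ne_top _ _),
    fun z hz => ?_⟩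
  obtain ⟨y, hy, hzy⟩ := Set.mem_iUnion₂.1 (hN hz)
  refine (hmin y hy).trans (measureReal_mono (Metric.ball_subset_ball' ?_))
  rw [dist_comm]
  linarith [Metric.mem_ball.1 hzy]

/-! ### The risk -/

theorem measurable_crossEntropy {E : Type*} [MeasurableSpace E] {q p : E → ℝ} (hq : Measurable q)
    (hp : Measurable p) : Measurable fun z => crossEntropy (q z) (p z) := by
  unfold crossEntropy
  fun_prop

theorem integrable_crossEntropy {E : Type*} [MeasurableSpace E] {ν : Measure E} [IsFiniteMeasure ν]
    {q p : E → ℝ} (hq : Measurable q) (hp : Measurable p) {c : ℝ} (hc : 0 < c)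
    (hqc : ∀ᵐ z ∂ν, c ≤ q z ∧ q z ≤ 1 - c) (hp01 : ∀ z, 0 ≤ p z ∧ p z ≤ 1) :
    Integrable (fun z => crossEntropy (q z) (p z)) ν := by
  refine Integrable.of_bound (measurable_crossEntropy hq hp).aestronglyMeasurable (-Real.log c) ?_
  filter_upwards [hqc] with z hz
  exact abs_crossEntropy_le hc hz.1 hz.2 (hp01 z).1 (hp01 z).2

/-- Comparison with `q = 1 / 2` bounds the Bernoulli entropy by `log 2`, even where `p` reaches `0`
or `1`. -/
theorem integrable_crossEntropy_self {E : Type*} [MeasurableSpace E] {ν : Measure E}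
    [IsFiniteMeasure ν] {p : E → ℝ} (hp : Measurable p) (hp01 : ∀ z, 0 ≤ p z ∧ p z ≤ 1) :
    Integrable (fun z => crossEntropy (p z) (p z)) ν := by
  refine Integrable.of_bound (measurable_crossEntropy hp hp).aestronglyMeasurable (-Real.log (1 / 2)) (ae_of_all _ fun z => ?_)
  obtain ⟨h0, h1⟩ := hp01 z
  have h2 := abs_crossEntropy_le (c := 1 / 2) (q := 1 / 2) (by norm_num) le_rfl (by norm_num) h0 h1
  have h3 := crossEntropy_self_add_le (q := 1 / 2) h0 h1 (by norm_num) (by norm_num)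
  rw [Real.norm_eq_abs, abs_of_nonneg (crossEntropy_nonneg h0 h1 h0 h1)]
  linarith [le_abs_self (crossEntropy (1 / 2) (p z)), sq_nonneg (p z - 1 / 2)]

/-- A function far from `p` on a set of positive measure has a risk exceeding the entropy. -/
theorem integral_crossEntropy_self_add_le {E : Type*} [MeasurableSpace E] {ν : Measure E}
    [IsFiniteMeasure ν] {q p : E → ℝ} (hq : Measurable q) (hp : Measurable p) {c : ℝ} (hc : 0 < c)
    (hqc : ∀ᵐ z ∂ν, c ≤ q z ∧ q z ≤ 1 - c) (hp01 : ∀ z, 0 ≤ p z ∧ p z ≤ 1) {B : Set E}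
    (hB : MeasurableSet B) {ε : ℝ} (hε : 0 ≤ ε) (hfar : ∀ᵐ z ∂ν, z ∈ B → ε ≤ |p z - q z|) :
    ∫ z, crossEntropy (p z) (p z) ∂ν + ν.real B * (ε ^ 2 / 4) ≤
      ∫ z, crossEntropy (q z) (p z) ∂ν := by
  have hi : Integrable (B.indicator fun _ => ε ^ 2 / 4) ν := (integrable_const _).indicator hB
  have hs := integrable_crossEntropy_self (ν := ν) hp hp01
  rw [← smul_eq_mul, ← integral_indicator_const _ hB, ← integral_add hs hi]
  refine integral_mono_ae (hs.add hi) (integrable_crossEntropy hq hp hc hqc hp01) ?_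
  filter_upwards [hqc, hfar] with z hz hzB
  have h := crossEntropy_self_add_le (hp01 z).1 (hp01 z).2 (hc.trans_le hz.1)
    (by linarith : q z < 1)
  refine le_trans (add_le_add_right ?_ _) h
  by_cases hzm : z ∈ B
  · rw [Set.indicator_of_mem hzm]
    have : ε ^ 2 ≤ (p z - q z) ^ 2 := by
      rw [← sq_abs (p z - q z)]
      exact pow_le_pow_left₀ hε (hzB hzm) 2
    linarith
  · rw [Set.indicator_of_notMem hzm]
    positivity

/-- A function close to `p` and bounded away from `0` and `1` has a risk close to the entropy. -/
theorem integral_crossEntropy_le_self_add {E : Type*} [MeasurableSpace E] {ν : Measure E}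
    [IsProbabilityMeasure ν] {q p : E → ℝ} (hq : Measurable q) (hp : Measurable p) {δ : ℝ}
    (hδ : 0 < δ) (hqδ : ∀ᵐ z ∂ν, δ ≤ q z ∧ q z ≤ 1 - δ) (hp01 : ∀ z, 0 ≤ p z ∧ p z ≤ 1)
    (hpq : ∀ᵐ z ∂ν, |p z - q z| ≤ 3 * δ) :
    ∫ z, crossEntropy (q z) (p z) ∂ν ≤ ∫ z, crossEntropy (p z) (p z) ∂ν + 18 * δ := by
  have hs := integrable_crossEntropy_self (ν := ν) hp hp01
  have hi : Integrable (fun _ : E => 18 * δ) ν := integrable_const _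
  calc ∫ z, crossEntropy (q z) (p z) ∂ν ≤ ∫ z, (crossEntropy (p z) (p z) + 18 * δ) ∂ν := by
        refine integral_mono_ae (integrable_crossEntropy hq hp hδ hqδ hp01) (hs.add hi) ?_
        filter_upwards [hqδ, hpq] with z hz hz'
        refine (crossEntropy_le_self_add (hp01 z).1 (hp01 z).2 (hδ.trans_le hz.1)
          (by linarith : q z < 1)).trans (add_le_add_right ?_ _)
        have h1 : (p z - q z) ^ 2 ≤ (3 * δ) ^ 2 := by
          rw [← sq_abs (p z - q z)]
          exact pow_le_pow_left₀ (abs_nonneg _) hz' 2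
        have h2 : 0 < q z * (1 - q z) := mul_pos (by linarith) (by linarith)
        rw [div_le_iff₀ h2]
        -- With this, the chi-square bound is at most `9 * δ ^ 2 / (δ / 2) = 18 * δ`.
        have h3 : δ / 2 ≤ q z * (1 - q z) := by
          rcases le_total (q z) (1 / 2) with h | h <;> nlinarith
        nlinarith
    _ = _ := by rw [integral_add hs hi]; simp

/-- The risk of `G` when the label given `z` is the indicator of an event of probability `p z`. -/
theorem integral_compProd_crossEntropy {E S : Type*} [MeasurableSpace E] [MeasurableSpace S]
    {ν : Measure E} [IsFiniteMeasure ν] {κ : Kernel E S} [IsMarkovKernel κ] {A : Set S}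
    (hA : MeasurableSet A) {G : E → ℝ} (hG : Measurable G) {c : ℝ} (hc : 0 < c)
    (hGc : ∀ᵐ z ∂ν, c ≤ G z ∧ G z ≤ 1 - c) :
    Integrable (fun y : E × S => crossEntropy (G y.1) (A.indicator 1 y.2)) (ν ⊗ₘ κ) ∧
    ∫ y, crossEntropy (G y.1) (A.indicator 1 y.2) ∂(ν ⊗ₘ κ) =
      ∫ z, crossEntropy (G z) ((κ z).real A) ∂ν := by
  have hind : Measurable (A.indicator (1 : S → ℝ)) := measurable_one.indicator hA
  have hset : MeasurableSet {z | c ≤ G z ∧ G z ≤ 1 - c} :=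
    (measurableSet_le measurable_const hG).inter (measurableSet_le hG measurable_const)
  have hint : Integrable (fun y : E × S => crossEntropy (G y.1) (A.indicator 1 y.2)) (ν ⊗ₘ κ) :=
    integrable_crossEntropy (hG.comp measurable_fst) (hind.comp measurable_snd) hc
      (Measure.ae_compProd_of_ae_fst κ hset hGc) fun y =>
        ⟨Set.indicator_nonneg (fun _ _ => zero_le_one) _,
          Set.indicator_le_self' (fun _ _ => zero_le_one) _⟩
  refine ⟨hint, ?_⟩
  rw [Measure.integral_compProd hint]
  congr 1
  ext z
  have hI : Integrable (A.indicator (1 : S → ℝ)) (κ z) :=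
    (integrable_const (1 : ℝ)).indicator hA
  -- The loss is affine in the label, so averaging replaces the label by its conditional
  -- probability.
  have h : ∀ y : S, crossEntropy (G z) (A.indicator 1 y) =
      -Real.log (1 - G z) + A.indicator 1 y * (Real.log (1 - G z) - Real.log (G z)) := fun y => by
    unfold crossEntropy
    ring
  simp only [h]
  rw [integral_add (integrable_const _) (hI.mul_const _), integral_mul_const,
    integral_indicator_one hA]
  simp only [integral_const, probReal_univ, one_smul]
  unfold crossEntropy
  ring

/-- The law of large numbers for the empirical loss of a fixed function. -/
theorem tendstoInMeasure_bceLoss {E S Ω : Type*} [MeasurableSpace E] [MeasurableSpace S]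
    [MeasurableSpace Ω] {ν : Measure E} [IsFiniteMeasure ν] {κ : Kernel E S} [IsMarkovKernel κ]
    {A : Set S} (hA : MeasurableSet A) {μ : Measure Ω} [IsProbabilityMeasure μ]
    {x : ℕ → Ω → E} {Y : ℕ → Ω → S} (hx : ∀ m, Measurable (x m)) (hY : ∀ m, Measurable (Y m))
    (h_indep : iIndepFun (fun m ω => (x m ω, Y m ω)) μ)
    (h_law : ∀ m, μ.map (fun ω => (x m ω, Y m ω)) = ν ⊗ₘ κ)
    {G : E → ℝ} (hG : Measurable G) {c : ℝ} (hc : 0 < c)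
    (hGc : ∀ᵐ z ∂ν, c ≤ G z ∧ G z ≤ 1 - c) :
    TendstoInMeasure μ
      (fun M ω => bceLoss G (fun m => x m ω) (fun m => A.indicator 1 (Y m ω)) M) atTop
      (fun _ => ∫ z, crossEntropy (G z) ((κ z).real A) ∂ν) := by
  obtain ⟨hint, hval⟩ := integral_compProd_crossEntropy (κ := κ) hA hG hc hGc
  set f : E × S → ℝ := fun y => crossEntropy (G y.1) (A.indicator 1 y.2)
  have hfm : Measurable f :=
    measurable_crossEntropy (hG.comp measurable_fst)
      ((measurable_one.indicator hA).comp measurable_snd)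
  have hxY : ∀ m, Measurable fun ω => (x m ω, Y m ω) := fun m => (hx m).prodMk (hY m)
  have hident : ∀ m, IdentDistrib (fun ω => f (x m ω, Y m ω)) (fun ω => f (x 0 ω, Y 0 ω)) μ μ :=
    fun m => (IdentDistrib.mk (hxY m).aemeasurable (hxY 0).aemeasurable
      ((h_law m).trans (h_law 0).symm)).comp hfm
  have hint0 : Integrable (fun ω => f (x 0 ω, Y 0 ω)) μ :=
    Integrable.comp_measurable (g := f) (by rwa [h_law]) (hxY 0)
  have hmean : ∫ ω, f (x 0 ω, Y 0 ω) ∂μ = ∫ z, crossEntropy (G z) ((κ z).real A) ∂ν := by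
    rw [← hval, ← h_law 0, integral_map (hxY 0).aemeasurable hfm.aestronglyMeasurable]
  have hslln := strong_law_ae_real (fun m ω => f (x m ω, Y m ω)) hint0
    (fun i j hij => (h_indep.indepFun hij).comp hfm hfm) hident
  rw [hmean] at hslln
  simp only [bceLoss_eq]
  refine tendstoInMeasure_of_tendsto_ae (fun M => ?_) hslln
  exact ((Finset.measurable_sum _ fun m _ => hfm.comp (hxY m)).div_const _).aestronglyMeasurable

/-! ### Measurability of networks and of the exit event -/

theorem measurable_leakyReLU (α : ℝ) : Measurable (leakyReLU α) :=
  Measurable.ite (measurableSet_le measurable_const measurable_id) measurable_id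
    (measurable_const_mul α)

theorem Network.measurable_logit (α : ℝ) {n : ℕ} (η : Network n) : Measurable (η.logit α) := by
  induction η with
  | output A B =>
    change Measurable fun v : Fin _ → ℝ => ∑ i, A i * v i + B
    fun_prop
  | hidden A B rest ih =>
    change Measurable fun v : Fin _ → ℝ => rest.logit α fun i => leakyReLU α (∑ j, A i j * v j + B i)
    refine ih.comp (measurable_pi_lambda _ fun i => (measurable_leakyReLU α).comp ?_)
    fun_prop

theorem Network.measurable_eval (α : ℝ) {d : ℕ} (η : Network d) : Measurable (η.eval α) := by
  unfold Network.eval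
  exact continuous_sigmoid.measurable.comp ((η.measurable_logit α).comp (by fun_prop))

theorem Network.eval_mem (α : ℝ) {d : ℕ} (η : Network d) (x : EuclideanSpace ℝ (Fin d)) :
    0 < η.eval α x ∧ η.eval α x < 1 :=
  ⟨Real.sigmoid_pos _, Real.sigmoid_lt_one _⟩

theorem exitTime_lt_iff {d : ℕ} {D : Set (EuclideanSpace ℝ (Fin d))} {w : PathSpace d} {T : ℝ≥0} :
    exitTime D w < T ↔ ∃ t : ℝ≥0, 0 < t ∧ t < T ∧ w t ∉ D := by
  simp only [exitTime, iInf_lt_iff, ENNReal.coe_lt_coe, exists_prop]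
  grind

/-- Staying in the open set `D` during a compact time interval is an open condition on the path, and
an exit before `T` violates it on one of countably many rational intervals. -/
theorem measurableSet_exitTime_lt {d : ℕ} {D : Set (EuclideanSpace ℝ (Fin d))} (hD : IsOpen D)
    (T : ℝ≥0) : MeasurableSet {w : PathSpace d | exitTime D w < T} := by
  have h : {w : PathSpace d | exitTime D w < T} =
      ⋃ (q : ℚ) (r : ℚ) (_ : Set.Icc (q : ℝ).toNNReal (r : ℝ).toNNReal ⊆ Set.Ioo 0 T),
        {w : PathSpace d | Set.MapsTo w (Set.Icc (q : ℝ).toNNReal (r : ℝ).toNNReal) D}ᶜ := by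
    ext w
    simp only [Set.mem_ofPred_eq, exitTime_lt_iff, Set.mem_iUnion, Set.mem_compl_iff, Set.MapsTo,
      exists_prop, not_forall]
    constructor
    · rintro ⟨t, ht0, htT, htD⟩
      obtain ⟨q, hq0, hqt⟩ := exists_rat_btwn (NNReal.coe_pos.2 ht0)
      obtain ⟨r, htr, hrT⟩ := exists_rat_btwn (NNReal.coe_lt_coe.2 htT)
      refine ⟨q, r, fun s hs => ⟨?_, ?_⟩, t, ⟨?_, ?_⟩, htD⟩
      · exact (Real.toNNReal_pos.2 hq0).trans_le hs.1
      · exact hs.2.trans_lt ((Real.toNNReal_lt_iff_lt_coe (t.2.trans htr.le)).2 hrT)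
      · exact Real.toNNReal_le_iff_le_coe.2 hqt.le
      · exact NNReal.le_toNNReal_of_coe_le htr.le
    · rintro ⟨q, r, hsub, t, ht, htD⟩
      exact ⟨t, (hsub ht).1, (hsub ht).2, htD⟩
  rw [h]
  exact .iUnion fun q => .iUnion fun r => .iUnion fun _ =>
    (ContinuousMap.isOpen_setOfPred_mapsTo isCompact_Icc hD).measurableSet.compl

theorem exitIndicator_eq {d : ℕ} (D : Set (EuclideanSpace ℝ (Fin d))) (T : ℝ≥0) :
    exitIndicator D T = {w | exitTime D w < T}.indicator 1 := by
  classical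
  ext w
  simp [exitIndicator, Set.indicator_apply]

/-! ### Consistency of empirical risk minimisation -/

/-- Near a point where it is far from `p`, a Lipschitz function stays far from `p`, and so does
every smoothed uniform approximation of it. -/
theorem le_abs_sub_smoothed {E : Type*} [PseudoMetricSpace E] {D : Set E} {p F : E → ℝ}
    {K L : ℝ≥0} (hp : LipschitzOnWith L p D) (hF : LipschitzOnWith K F D) {ε δ q : ℝ}
    {z₀ z : E} (hz₀ : z₀ ∈ D) (hz : z ∈ D) (hdist : dist z z₀ < ε / (8 * (K + L + 1)))
    (hfar : ε / 2 < |F z₀ - p z₀|) (hδ : 0 < δ) (hδε : δ ≤ ε / 16) (hq : 0 ≤ q ∧ q ≤ 1)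
    (hFq : |F z - q| ≤ ε / 16) : ε / 4 ≤ |p z - smoothed δ q| := by
  have h1 := hp.dist_le_mul z hz z₀ hz₀
  have h2 := hF.dist_le_mul z hz z₀ hz₀
  rw [Real.dist_eq] at h1 h2
  -- Of the initial gap `ε / 2`, the displacement uses `ε / 8`, the approximation and the smoothing
  -- `ε / 16` each.
  have h3 : (K + L) * dist z z₀ ≤ ε / 8 := by
    rw [lt_div_iff₀ (by positivity)] at hdist
    have := dist_nonneg (x := z) (y := z₀)
    nlinarith
  have h4 := abs_smoothed_sub_le hδ hq.1 hq.2
  have h5 : F z₀ - p z₀ = -(F z - F z₀) + (F z - q) + -(smoothed δ q - q) + (p z - p z₀) +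
    -(p z - smoothed δ q) := by ring
  have h6 : |F z₀ - p z₀| ≤ |F z - F z₀| + |F z - q| + |smoothed δ q - q| + |p z - p z₀| +
      |p z - smoothed δ q| := by
    rw [h5]
    have := abs_neg (F z - F z₀)
    have := abs_neg (smoothed δ q - q)
    have := abs_neg (p z - smoothed δ q)
    refine (abs_add_le _ _).trans (add_le_add ?_ this.le)
    refine (abs_add_le _ _).trans (add_le_add_left ?_ _)
    refine (abs_add_le _ _).trans (add_le_add ?_ (by simp only [abs_neg, le_refl]))
    exact (abs_add_le _ _).trans (add_le_add_left (by simp only [abs_neg, le_refl]) _)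
  linarith

/-- Clamping `p` to `[2δ, 1 - 2δ]` keeps it `L`-Lipschitz and moves it by at most `2δ`; an
approximation within `δ` then stays away from `0` and `1`. -/
theorem exists_comparator {E ι : Type*} [PseudoMetricSpace E] {D : Set E} {p : E → ℝ} {L : ℝ≥0}
    (hp : LipschitzOnWith L p D) (hp01 : ∀ z, 0 ≤ p z ∧ p z ≤ 1) {F : ι → E → ℝ} {H : Set ι}
    (h_approx : ∀ g : E → ℝ, LipschitzOnWith L g D → (∀ z ∈ D, 0 ≤ g z ∧ g z ≤ 1) →
      ∀ ε > 0, ∃ θ ∈ H, ∀ z ∈ D, |F θ z - g z| < ε)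
    {δ : ℝ} (hδ : 0 < δ) (hδ1 : δ ≤ 1 / 4) :
    ∃ θ ∈ H, ∀ z ∈ D, (δ ≤ F θ z ∧ F θ z ≤ 1 - δ) ∧ |p z - F θ z| ≤ 3 * δ := by
  have hg : LipschitzOnWith L (fun z => max (2 * δ) (min (p z) (1 - 2 * δ))) D := by
    have h := ((LipschitzWith.id.min_const (1 - 2 * δ)).const_max (2 * δ)).comp_lipschitzOnWith hp
    rwa [one_mul] at h
  have hcl : ∀ z, 2 * δ ≤ max (2 * δ) (min (p z) (1 - 2 * δ)) ∧
      max (2 * δ) (min (p z) (1 - 2 * δ)) ≤ 1 - 2 * δ ∧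
      |max (2 * δ) (min (p z) (1 - 2 * δ)) - p z| ≤ 2 * δ := fun z => by
    obtain ⟨h0, h1⟩ := hp01 z
    rw [abs_le]
    refine ⟨le_max_left _ _, max_le (by linarith) (min_le_right _ _), ?_, ?_⟩
    · have := le_max_right (2 * δ) (min (p z) (1 - 2 * δ))
      rcases min_cases (p z) (1 - 2 * δ) with h | h <;> linarith
    · have := max_le (a := 2 * δ) (b := min (p z) (1 - 2 * δ)) (c := p z + 2 * δ) (by linarith)
        ((min_le_left _ _).trans (by linarith))
      linarith
  obtain ⟨θ, hθ, h⟩ := h_approx _ hg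
    (fun z _ => ⟨by linarith [(hcl z).1], by linarith [(hcl z).2.1]⟩) δ hδ
  refine ⟨θ, hθ, fun z hz => ?_⟩
  obtain ⟨h1, h2, h3⟩ := hcl z
  have h4 := abs_lt.1 (h z hz)
  have h5 := abs_le.1 h3
  exact ⟨⟨by linarith, by linarith⟩, abs_le.2 ⟨by linarith, by linarith⟩⟩

/-- Empirical minimisers of the cross-entropy over a sufficiently rich class of Lipschitz functions
converge uniformly to the conditional probability of the label. -/
theorem tendstoInMeasure_iSup_abs_sub {E S ι Ω : Type*} [PseudoMetricSpace E] [MeasurableSpace E]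
    [OpensMeasurableSpace E] [MeasurableSpace S] [MeasurableSpace Ω]
    {D : Set E} (hD : TotallyBounded D) {ν : Measure E} [IsProbabilityMeasure ν]
    (hDm : MeasurableSet D) (hνD : ∀ᵐ z ∂ν, z ∈ D)
    (hν : ∀ z ∈ D, ∀ r > 0, 0 < ν (Metric.ball z r))
    {κ : Kernel E S} [IsMarkovKernel κ] {A : Set S} (hA : MeasurableSet A)
    {L : ℝ≥0} (hL : LipschitzOnWith L (fun z => (κ z).real A) D)
    {μ : Measure Ω} [IsProbabilityMeasure μ] {x : ℕ → Ω → E} {Y : ℕ → Ω → S}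
    (hx : ∀ m, Measurable (x m)) (hY : ∀ m, Measurable (Y m))
    (h_indep : iIndepFun (fun m ω => (x m ω, Y m ω)) μ)
    (h_law : ∀ m, μ.map (fun ω => (x m ω, Y m ω)) = ν ⊗ₘ κ)
    {F : ι → E → ℝ} (hFm : ∀ θ, Measurable (F θ)) (hF : ∀ θ z, 0 < F θ z ∧ F θ z < 1)
    {H : Set ι} {K : ℝ≥0} (hK : ∀ θ ∈ H, LipschitzOnWith K (F θ) D)
    (h_approx : ∀ g : E → ℝ, LipschitzOnWith L g D → (∀ z ∈ D, 0 ≤ g z ∧ g z ≤ 1) →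
      ∀ ε > 0, ∃ θ ∈ H, ∀ z ∈ D, |F θ z - g z| < ε)
    {η : ℕ → Ω → ι} (hη : ∀ M ω, η M ω ∈ H)
    (h_min : TendstoInMeasure μ
      (fun M ω => bceLoss (F (η M ω)) (fun m => x m ω) (fun m => A.indicator 1 (Y m ω)) M -
        ⨅ θ : H, bceLoss (F θ) (fun m => x m ω) (fun m => A.indicator 1 (Y m ω)) M)
      atTop (fun _ => 0)) :
    TendstoInMeasure μ (fun M ω => ⨆ z : D, |F (η M ω) z - (κ z).real A|) atTop (fun _ => 0) := by
  set p : E → ℝ := fun z => (κ z).real A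
  have hpm : Measurable p := (κ.measurable_coe hA).ennreal_toReal
  have hp01 : ∀ z, 0 ≤ p z ∧ p z ≤ 1 := fun z => ⟨measureReal_nonneg, measureReal_le_one⟩
  have hind : ∀ y : S, 0 ≤ A.indicator (1 : S → ℝ) y ∧ A.indicator (1 : S → ℝ) y ≤ 1 := fun y =>
    ⟨Set.indicator_nonneg (fun _ _ => zero_le_one) _,
      Set.indicator_le_self' (fun _ _ => zero_le_one) _⟩
  have hxD : ∀ᵐ ω ∂μ, ∀ m, x m ω ∈ D := ae_all_iff.2 fun m => by
    have h : ∀ᵐ y ∂(μ.map fun ω => (x m ω, Y m ω)), y.1 ∈ D := by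
      rw [h_law]
      exact Measure.ae_compProd_of_ae_fst κ hDm hνD
    exact ae_of_ae_map ((hx m).prodMk (hY m)).aemeasurable h
  rw [tendstoInMeasure_iff_norm] at h_min ⊢
  intro ε hε
  simp only [sub_zero, Real.norm_eq_abs] at h_min ⊢
  obtain ⟨c, hc, hball⟩ := exists_pos_le_measureReal_ball (ν := ν) hD hν
    (r := ε / (8 * (K + L + 1))) (by positivity)
  set Γ : ℝ := c * ((ε / 4) ^ 2 / 4) with hΓ
  have hΓ0 : 0 < Γ := by positivity
  -- The errors add up to `Γ / 2 + 23 * δ`: optimisation `Γ / 2`, comparator `18 * δ`, smoothing `3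
  -- * δ`, and two deviations of `δ`. This must stay below `Γ`.
  obtain ⟨δ, hδ, hδε, hδ1, hδΓ⟩ : ∃ δ > 0, δ ≤ ε / 16 ∧ δ ≤ 1 / 4 ∧ 50 * δ ≤ Γ := by
    refine ⟨min (ε / 16) (min (1 / 4) (Γ / 50)), by positivity, min_le_left _ _,
      (min_le_right _ _).trans (min_le_left _ _), ?_⟩
    linarith [(min_le_right (ε / 16) _).trans (min_le_right (1 / 4) (Γ / 50))]
  obtain ⟨θ₀, hθ₀H, hθ₀⟩ := exists_comparator hL hp01 h_approx hδ hδ1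
  -- Radius `δ ^ 2`, because smoothing divides it by `δ`.
  obtain ⟨T, hTH, hTfin, hT⟩ := exists_finite_uniform_approx hD hK
    (fun θ _ z => ⟨(hF θ z).1.le, (hF θ z).2.le⟩) (by positivity : 0 < δ ^ 2)
  have hsmd : ∀ τ, ∀ᵐ z ∂ν, δ / 3 ≤ smoothed δ (F τ z) ∧ smoothed δ (F τ z) ≤ 1 - δ / 3 :=
    fun τ => ae_of_all _ fun z => smoothed_mem hδ (by linarith) (hF τ z).1.le (hF τ z).2.le
  have hsmdm : ∀ τ, Measurable fun z => smoothed δ (F τ z) := fun τ =>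
    ((hFm τ).add_const δ).div_const _
  have hθ₀ae : ∀ᵐ z ∂ν, δ ≤ F θ₀ z ∧ F θ₀ z ≤ 1 - δ := by
    filter_upwards [hνD] with z hz using (hθ₀ z hz).1
  have hrisk₀ := integral_crossEntropy_le_self_add (ν := ν) (hFm θ₀) hpm hδ hθ₀ae hp01
    (by filter_upwards [hνD] with z hz using (hθ₀ z hz).2)
  let loss : (E → ℝ) → ℕ → Ω → ℝ := fun G M ω =>
    bceLoss G (fun m => x m ω) (fun m => A.indicator 1 (Y m ω)) M
  let risk : (E → ℝ) → ℝ := fun G => ∫ z, crossEntropy (G z) (p z) ∂ν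
  have hlim₀ : Tendsto (fun M => μ {ω | δ ≤ |loss (F θ₀) M ω - risk (F θ₀)|}) atTop (𝓝 0) := by
    simpa only [Real.norm_eq_abs] using tendstoInMeasure_iff_norm.1
      (tendstoInMeasure_bceLoss hA hx hY h_indep h_law (hFm θ₀) hδ hθ₀ae) δ hδ
  have hlim : Tendsto (fun M => ∑ τ ∈ hTfin.toFinset, μ {ω | δ ≤
      |loss (fun z => smoothed δ (F τ z)) M ω - risk (fun z => smoothed δ (F τ z))|})
      atTop (𝓝 0) := by
    rw [← Finset.sum_const_zero (s := hTfin.toFinset)]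
    refine tendsto_finsetSum _ fun τ _ => ?_
    simpa only [Real.norm_eq_abs] using tendstoInMeasure_iff_norm.1
      (tendstoInMeasure_bceLoss hA hx hY h_indep h_law (hsmdm τ) (by positivity : 0 < δ / 3)
        (hsmd τ)) δ hδ
  have hsum := ((h_min (Γ / 2) (by positivity)).add hlim₀).add hlim
  simp only [add_zero] at hsum
  refine tendsto_of_tendsto_of_tendsto_of_le_of_le tendsto_const_nhds hsum
    (fun _ => zero_le) fun M => ?_
  -- Monotonicity and subadditivity hold for arbitrary sets, so no measurability of `η M` enters.
  refine (measure_mono_ae ?_).trans ((measure_union_le _ _).trans (add_le_add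
    (measure_union_le _ _) (measure_biUnion_finset_le hTfin.toFinset _)))
  filter_upwards [hxD] with ω hω hbad
  replace hbad : ε ≤ |(⨆ z : D, |F (η M ω) z - p z|)| := hbad
  by_contra hcon
  change ¬((Γ / 2 ≤ |_| ∨ δ ≤ |_|) ∨ ω ∈ ⋃ τ ∈ hTfin.toFinset, {ω | δ ≤ |_|}) at hcon
  simp only [Set.mem_iUnion, Set.Finite.mem_toFinset, Set.mem_ofPred_eq, not_or, not_exists,
    not_le] at hcon
  obtain ⟨⟨hexcess, hdev₀⟩, hdev⟩ := hcon
  rw [abs_of_nonneg (Real.iSup_nonneg fun _ => abs_nonneg _)] at hbad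
  obtain ⟨⟨z₀, hz₀⟩, hfar⟩ : ∃ z : D, ε / 2 < |F (η M ω) z - p z| := by
    by_contra! h
    linarith [Real.iSup_le h (by positivity)]
  obtain ⟨τ, hτT, hτ⟩ := hT _ (hη M ω)
  have hgap := integral_crossEntropy_self_add_le (hsmdm τ) hpm (by positivity : 0 < δ / 3) (hsmd τ)
    hp01 (Metric.isOpen_ball (x := z₀) (ε := ε / (8 * (K + L + 1)))).measurableSet
    (by positivity : 0 ≤ ε / 4) (by
      filter_upwards [hνD] with z hz hzB
      refine le_abs_sub_smoothed hL (hK _ (hη M ω)) hz₀ hz hzB hfar hδ hδε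
        ⟨(hF τ z).1.le, (hF τ z).2.le⟩ ((hτ z hz).trans ?_)
      nlinarith)
  have hmass := mul_le_mul_of_nonneg_right (hball z₀ hz₀)
    (by positivity : 0 ≤ (ε / 4) ^ 2 / 4)
  have hcover : loss (fun z => smoothed δ (F τ z)) M ω ≤
      loss (F (η M ω)) M ω + (δ ^ 2 / δ + 2 * δ) := by
    refine bceLoss_le_add (by positivity) fun m => ?_
    exact crossEntropy_smoothed_le hδ (hF _ _).1 (hF _ _).2 (hF _ _).1.le (hF _ _).2.le
      (hind _).1 (hind _).2 (hτ _ (hω m))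
  rw [pow_two, mul_div_cancel_right₀ _ hδ.ne'] at hcover
  have hinf : ⨅ θ : H, loss (F θ) M ω ≤ loss (F θ₀) M ω := by
    refine ciInf_le ⟨0, ?_⟩ (⟨θ₀, hθ₀H⟩ : H)
    rintro _ ⟨θ, rfl⟩
    exact bceLoss_nonneg (fun z => ⟨(hF θ z).1.le, (hF θ z).2.le⟩) (fun _ => hind _) M
  have h1 := (abs_lt.1 hexcess).2
  have h2 := (abs_lt.1 hdev₀).2
  have h3 := (abs_lt.1 (hdev τ hτT)).1
  change loss (F (η M ω)) M ω - ⨅ θ : H, loss (F θ) M ω < Γ / 2 at h1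
  change risk (F θ₀) ≤ _ at hrisk₀
  change _ ≤ risk fun z => smoothed δ (F τ z) at hgap
  linarith

end ExitLearning

end

theorem theorem1 {d k : ℕ}
    -- the open bounded domain and the time step
    (D : Set (EuclideanSpace ℝ (Fin d))) (hD_open : IsOpen D) (hD_bdd : Bornology.IsBounded D)
    (Δt : ℝ≥0) (hΔt : 0 < Δt)
    -- the SDE, and the laws `κ x` of its solutions started at `x`
    (a : EuclideanSpace ℝ (Fin d) → EuclideanSpace ℝ (Fin d)) (ha : ∃ K, LipschitzWith K a)
    (b : EuclideanSpace ℝ (Fin d) → EuclideanSpace ℝ (Fin k) →L[ℝ] EuclideanSpace ℝ (Fin d))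
    (hb : ∃ K, LipschitzWith K b)
    (κ : Kernel (EuclideanSpace ℝ (Fin d)) (PathSpace d)) [IsMarkovKernel κ]
    (hκ : ∀ x ∈ D, IsSDELaw a b x (κ x))
    -- the exit probability is `L`-Lipschitz on `D`
    (L : ℝ≥0) (hL : LipschitzOnWith L (fun x => exitProb D Δt (κ x)) D)
    -- the density of the starting points
    (ρ : EuclideanSpace ℝ (Fin d) → ℝ) (ρmin ρmax : ℝ) (hρ_cont : ContinuousOn ρ D)
    (hρmin : 0 < ρmin) (hρ : ∀ x ∈ D, ρmin ≤ ρ x ∧ ρ x ≤ ρmax)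
    -- i.i.d. starting points `x m ∼ ρ`, and trajectories `Y m` of the SDE started there
    {Ω : Type*} [MeasurableSpace Ω] (μ : Measure Ω) [IsProbabilityMeasure μ]
    (x : ℕ → Ω → EuclideanSpace ℝ (Fin d)) (Y : ℕ → Ω → PathSpace d)
    (hx : ∀ m, Measurable (x m)) (hY : ∀ m, Measurable (Y m))
    (h_indep : iIndepFun (fun m ω => (x m ω, Y m ω)) μ)
    (h_law : ∀ m, μ.map (fun ω => (x m ω, Y m ω)) =
      ((volume.restrict D).withDensity (fun z => ENNReal.ofReal (ρ z))) ⊗ₘ κ)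
    -- the admissible networks: `LF`-Lipschitz on `D`, with sufficient approximation capability
    (α : ℝ) (hα : 0 < α ∧ α < 1) (H : Set (Network d))
    (LF : ℝ≥0) (hLF : ∀ θ ∈ H, LipschitzOnWith LF (θ.eval α) D)
    (h_approx : ∀ g : EuclideanSpace ℝ (Fin d) → ℝ, LipschitzOnWith L g D →
      (∀ z ∈ D, 0 ≤ g z ∧ g z ≤ 1) →
      ∀ ε > 0, ∃ θ ∈ H, ∀ z ∈ D, |θ.eval α z - g z| < ε)
    -- the trained networks: the BCE loss converges to its global minimum over `H`
    (η : ℕ → Ω → Network d) (hη : ∀ M ω, η M ω ∈ H)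
    (h_min : TendstoInMeasure μ
      (fun M ω =>
        bceLoss ((η M ω).eval α) (fun m => x m ω) (fun m => exitIndicator D Δt (Y m ω)) M -
        ⨅ θ : H, bceLoss ((θ : Network d).eval α) (fun m => x m ω)
          (fun m => exitIndicator D Δt (Y m ω)) M)
      atTop (fun _ => 0)) :
    TendstoInMeasure μ
      (fun M ω => ⨆ z : D, |(η M ω).eval α z - exitProb D Δt (κ z)|) atTop (fun _ => 0) := by
  have hA := measurableSet_exitTime_lt hD_open Δt
  simp only [exitIndicator_eq] at h_min
  -- The normalisation of `ρ` is read off from the first marginal of the law of a sample.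
  have hprob : IsProbabilityMeasure
      ((volume.restrict D).withDensity fun z => ENNReal.ofReal (ρ z)) := by
    rw [← Measure.fst_compProd (((volume.restrict D).withDensity fun z => ENNReal.ofReal (ρ z))) κ,
      ← h_law 0]
    have := Measure.isProbabilityMeasure_map (μ := μ) ((hx 0).prodMk (hY 0)).aemeasurable
    infer_instance
  refine tendstoInMeasure_iSup_abs_sub (TotallyBounded.subset subset_closure
      hD_bdd.isCompact_closure.totallyBounded) hD_open.measurableSet
    ((withDensity_absolutelyContinuous _ _).ae_le (ae_restrict_mem hD_open.measurableSet))
    (fun z hz r hr => ?_) hA hL hx hY h_indep h_law (fun θ => θ.measurable_eval α)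
    (fun θ z => θ.eval_mem α z) hLF h_approx hη h_min
  -- Balls are charged because `ρ ≥ ρmin` on this nonempty open set.
  have hopen : IsOpen (Metric.ball z r ∩ D) := Metric.isOpen_ball.inter hD_open
  have hpos : 0 < volume (Metric.ball z r ∩ D) :=
    hopen.measure_pos _ ⟨z, Metric.mem_ball_self hr, hz⟩
  refine lt_of_lt_of_le ?_ (measure_mono (Set.inter_subset_left (t := D)))
  rw [withDensity_apply _ hopen.measurableSet, Measure.restrict_restrict hopen.measurableSet,
    Set.inter_assoc, Set.inter_self]
  calc 0 < ENNReal.ofReal ρmin * volume (Metric.ball z r ∩ D) :=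
        ENNReal.mul_pos (ENNReal.ofReal_pos.2 hρmin).ne' hpos.ne'
    _ = ∫⁻ _ in Metric.ball z r ∩ D, ENNReal.ofReal ρmin := (setLIntegral_const _ _).symm
    _ ≤ _ := setLIntegral_mono' hopen.measurableSet fun y hy =>
        ENNReal.ofReal_le_ofReal (hρ y hy.2).1
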